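/- Let $\mathbb{K}=\mathbb{R}$ or $\mathbb{C}$. For a locally convex Hausdorff space $E$ over $\mathbb{K}$ let $E'$ be its topological dual and $E_b'$ its strong dual, i.e. $E'$ with the topology of uniform convergence on bounded subsets of $E$. "Topological isomorphism" means linear homeomorphism. Let $\mathcal{F}(\Omega)$ be a locally convex Hausdorff space of $\mathbb{K}$-valued functions on a non-empty set $\Omega$ (a linear subspace of $\mathbb{K}^\Omega$ with some locally convex Hausdorff topology). * A *predual* of $\mathcal{F}(\Omega)$ is a pair $(Z,\psi)$ of a locally convex Hausdorff space $Z$ over $\mathbb{K}$ and a topological isomorphism $\psi\colon\mathcal{F}(\Omega)\to Z_b'$. Two preduals are *equivalent*, $(Z,\psi)\sim(Y,\varphi)$, if there is a topological isomorphism $\lambda\colon Y\to Z$ with $z'\circ\lambda=\varphi(\psi^{-1}(z'))$ for all $z'\in Z'$. * A *strong linearisation* of $\mathcal{F}(\Omega)$ is a triple $(\delta,Y,T)$ of a predual $(Y,T)$ and a map $\delta\colon\Omega\to Y$ with $T(f)\circ\delta=f$ for all $f\in\mathcal{F}(\Omega)$. * $\mathcal{F}(\Omega,Z)_{\sigma,b}$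 is the set of all $f\colon\Omega\to Z$ such that $z'\circ f\in\mathcal{F}(\Omega)$ for all $z'\in Z'$ and such that, for all continuous seminorms $q$ on $\mathcal{F}(\Omega)$ and $p$ on $Z$, $\sup\{q(z'\circ f) : z'\in Z',\ |z'(z)|\le 1 \text{ whenever } p(z)<1\}<\infty$. * A locally convex Hausdorff space $E$ is *webbed* if there are absolutely convex sets $C_{n_1,\dots,n_k}\subset E$ ($k\ge1$, $n_i\in\mathbb{N}$) with $E=\bigcup_n C_n$, $C_{n_1,\dots,n_k}=\bigcup_n C_{n_1,\dots,n_k,n}$, such that for each sequence $(n_k)$ there are $c_k>0$ for which $\sum_k c_kx_k$ converges in $E$ whenever $x_k\in C_{n_1,\dots,n_k}$ for all $k$. It is *ultrabornological* if it is an inductive limit of Banach spaces, i.e. an absolutely convex $U\subset E$ is a zero neighbourhood whenever its preimage under every continuous linear map from a Banach space to $E$ is a zero neighbourhood. It is *$B_r$-complete* if the only $\sigma(E',E)$-dense linear subspace $M\subset E'$ such that $M\cap U^\circ$ is $\sigma(E',E)$-closed for every zero neighbourhood $U$ is $M=E'$. It is a *BC-space* if every linear map with closed graph from a Banach space to $E$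 is continuous. **Theorem.** Let $(\delta,Y,T)$ be a strong linearisation of $\mathcal{F}(\Omega)$ and $(Z,\widetilde T)$ a predual of $\mathcal{F}(\Omega)$ such that $Z$ is complete. Suppose that 1. $Y$ is complete, barrelled and webbed and $Z$ is ultrabornological, or 2. $Y$ is $B_r$-complete and barrelled and $Z$ is barrelled. Consider the assertions * (a) There exists $\widetilde\delta\in\mathcal{F}(\Omega,Z)_{\sigma,b}$ such that $(\widetilde\delta,Z,\widetilde T)$ is a strong linearisation of $\mathcal{F}(\Omega)$. * (b) $(Z,\widetilde T)\sim(Y,T)$. Then (a) implies (b). If, in addition, $\mathcal{F}(\Omega)$ is a BC-space and the point evaluation $f\mapsto f(x)$ is continuous on $\mathcal{F}(\Omega)$ for every $x\in\Omega$, then (b) implies (a). -/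

import Mathlib

open Filter Topology
open scoped ComplexOrder

/-! Throughout, `𝕜` is `ℝ` or `ℂ`, and a locally convex Hausdorff space over `𝕜` is a Hausdorff
topological vector space whose topology is generated by seminorms (`PolynormableSpace 𝕜 E`).
`StrongDual 𝕜 E = E →L[𝕜] 𝕜` carries Mathlib's topology of uniform convergence on bounded
subsets, so it is the strong dual `E'_b`. -/

section FunctionSpaces

/-- A linear space of `𝕜`-valued functions on `Ω`, as a vector space. It deliberately does not
inherit the topology of pointwise convergence, so that it can be given a topology of its own. -/
def FunctionSpace {𝕜 Ω : Type*} [RCLike 𝕜] (F : Submodule 𝕜 (Ω → 𝕜)) : Type _ := F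

namespace FunctionSpace

variable {𝕜 Ω : Type*} [RCLike 𝕜] (F : Submodule 𝕜 (Ω → 𝕜))

instance : AddCommGroup (FunctionSpace F) := inferInstanceAs (AddCommGroup F)

instance : Module 𝕜 (FunctionSpace F) := inferInstanceAs (Module 𝕜 F)

instance : CoeFun (FunctionSpace F) (fun _ => Ω → 𝕜) := ⟨fun f => f.1⟩

end FunctionSpace

/-- The set `F(Ω,E)_{σ,b}` of all `f : Ω → E` such that `e' ∘ f ∈ F` for every `e' ∈ E'`, and such
that for all continuous seminorms `q` on `F` and `p` on `E` the supremum of `q (e' ∘ f)` over `e'`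
in the polar of `{x | p x < 1}` is finite. -/
def weakBoundedFunctions {𝕜 Ω : Type*} [RCLike 𝕜] (F : Submodule 𝕜 (Ω → 𝕜))
    [TopologicalSpace (FunctionSpace F)] (E : Type*) [AddCommGroup E] [Module 𝕜 E]
    [TopologicalSpace E] : Set (Ω → E) :=
  {f | ∃ hf : ∀ e' : StrongDual 𝕜 E, (fun x => e' (f x)) ∈ F,
    ∀ (q : Seminorm 𝕜 (FunctionSpace F)) (p : Seminorm 𝕜 E), Continuous q → Continuous p →
      BddAbove ((fun e' : StrongDual 𝕜 E => q (⟨fun x => e' (f x), hf e'⟩ : FunctionSpace F)) ''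
        {e' | ∀ x : E, p x < 1 → ‖e' x‖ ≤ 1})}

/-- `(δ, Y, T)` is a strong linearisation of `F`: `T` is a topological isomorphism of `F` onto the
strong dual of `Y`, and `T f ∘ δ = f` for all `f ∈ F`. -/
def IsStrongLinearisation {𝕜 Ω : Type*} [RCLike 𝕜] {F : Submodule 𝕜 (Ω → 𝕜)}
    [TopologicalSpace (FunctionSpace F)] {Y : Type*} [AddCommGroup Y] [Module 𝕜 Y]
    [TopologicalSpace Y] (δ : Ω → Y) (T : FunctionSpace F ≃L[𝕜] StrongDual 𝕜 Y) : Prop :=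
  ∀ f : FunctionSpace F, (fun x => T f (δ x)) = f

end FunctionSpaces

section LocallyConvexSpaces

universe u

/-- The equivalence `(Z, ψ) ∼ (Y, φ)` of two preduals of `X`: there is a topological isomorphism
`lam : Y → Z` whose dual map `z' ↦ z' ∘ lam` is `φ ∘ ψ⁻¹`. -/
def PredualEquiv {𝕜 X Y Z : Type*} [RCLike 𝕜] [AddCommGroup X] [Module 𝕜 X] [TopologicalSpace X]
    [AddCommGroup Y] [Module 𝕜 Y] [TopologicalSpace Y]
    [AddCommGroup Z] [Module 𝕜 Z] [TopologicalSpace Z]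
    (ψ : X ≃L[𝕜] StrongDual 𝕜 Z) (φ : X ≃L[𝕜] StrongDual 𝕜 Y) : Prop :=
  ∃ lam : Y ≃L[𝕜] Z, ∀ z' : StrongDual 𝕜 Z, z'.comp (lam : Y →L[𝕜] Z) = φ (ψ.symm z')

variable (𝕜 : Type*) [RCLike 𝕜]

/-- `E` is webbed (in the sense of de Wilde): there are absolutely convex sets `C_{n₀,…,nₖ}`,
indexed by finite sequences, with `E = ⋃ₙ C_n` and `C_{n₀,…,nₖ} = ⋃ₙ C_{n₀,…,nₖ,n}`, such that for
every sequence `(nₖ)` there are `cₖ > 0` such that `∑ cₖ xₖ` converges whenever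
`xₖ ∈ C_{n₀,…,nₖ}` for all `k`. The empty sequence is allowed as an index; its set is `E`. -/
def IsWebbed (E : Type*) [AddCommGroup E] [Module 𝕜 E] [TopologicalSpace E] : Prop :=
  ∃ C : List ℕ → Set E,
    (∀ s, AbsConvex 𝕜 (C s)) ∧ C [] = Set.univ ∧ (∀ s, C s = ⋃ n : ℕ, C (s ++ [n])) ∧
    ∀ n : ℕ → ℕ, ∃ c : ℕ → ℝ, (∀ k, 0 < c k) ∧
      ∀ x : ℕ → E, (∀ k, x k ∈ C ((List.range (k + 1)).map n)) →
        ∃ y : E, Tendsto (fun N => ∑ k ∈ Finset.range N, (c k : 𝕜) • x k) atTop (𝓝 y)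

/-- `E` is ultrabornological, i.e. an inductive limit of Banach spaces: an absolutely convex subset
is a neighbourhood of zero as soon as its preimage under each continuous linear map from a Banach
space is one. Every such map factors through an injective one, whose domain can be
realised on a subset of `E`, so Banach spaces in the universe of `E` suffice. -/
def IsUltrabornological (E : Type u) [AddCommGroup E] [Module 𝕜 E]
    [TopologicalSpace E] : Prop :=
  ∀ U : Set E, AbsConvex 𝕜 U →
    (∀ (X : Type u) [NormedAddCommGroup X] [NormedSpace 𝕜 X] [CompleteSpace X] (i : X →L[𝕜] E),
      i ⁻¹' U ∈ 𝓝 (0 : X)) → U ∈ 𝓝 (0 : E)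

/-- `E` is `B_r`-complete: the only weak*-dense linear subspace `M` of `E'` for which `M ∩ U°` is
weak*-closed for every neighbourhood `U` of zero is `E'` itself. -/
def IsBrComplete (E : Type*) [AddCommGroup E] [Module 𝕜 E] [TopologicalSpace E] : Prop :=
  ∀ M : Submodule 𝕜 (WeakDual 𝕜 E), Dense (M : Set (WeakDual 𝕜 E)) →
    (∀ U ∈ 𝓝 (0 : E), IsClosed ((M : Set (WeakDual 𝕜 E)) ∩ WeakDual.polar 𝕜 U)) → M = ⊤

/-- `E` is a BC-space: every linear map with closed graph from a Banach space to `E` is continuous.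
Since such a map has closed kernel, it factors through an injective one with the same property,
so Banach spaces in the universe of `E` suffice. -/
def IsBCSpace (E : Type u) [AddCommGroup E] [Module 𝕜 E] [TopologicalSpace E] : Prop :=
  ∀ (X : Type u) [NormedAddCommGroup X] [NormedSpace 𝕜 X] [CompleteSpace X] (f : X →ₗ[𝕜] E),
    IsClosed (f.graph : Set (X × E)) → Continuous f

end LocallyConvexSpaces

/-! Put `S = T ∘ T'⁻¹`, a topological isomorphism from `Z'_b` onto `Y'_b`; equivalence of the
preduals says that `S` is the transpose of a topological isomorphism `lam : Y → Z`. Given (a), `S f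
(δ x) = f (δ' x)`, so `S` is a transpose on the span of `δ(Ω)`, which is dense by Hahn-Banach. Both
cases make `Y` and `Z` barrelled, so `S` and `S⁻¹` preserve equicontinuity
(`BarrelledSpace.exists_seminorm_of_strongDual_map`). For `S` this gives continuity on the span,
hence an extension `lam` to `Y` because `Z` is complete; for `S⁻¹` it makes `lam` an embedding. Its
range is dense since `S` is injective. Surjectivity follows from completeness of `Y`, or from
`B_r`-completeness applied to a hyperplane of `Y'`. Conversely, `lam ∘ δ` is the required map. -/

/-! ### Hahn-Banach, seminorms and polars -/

section PolynormableSpaces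

variable {𝕜 : Type*} [RCLike 𝕜]

/-- A subspace annihilated by no nonzero continuous functional is dense. -/
theorem Submodule.dense_of_forall_strongDual_eq_zero {E : Type*} [AddCommGroup E] [Module 𝕜 E]
    [TopologicalSpace E] [IsTopologicalAddGroup E] [ContinuousSMul 𝕜 E] [PolynormableSpace 𝕜 E]
    (D : Submodule 𝕜 E) (hD : ∀ f : StrongDual 𝕜 E, (∀ x ∈ D, f x = 0) → f = 0) :
    Dense (D : Set E) := by
  let _ : Module ℝ E := .restrictScalars ℝ 𝕜 E
  have _ : IsScalarTower ℝ 𝕜 E := .restrictScalars _ _ _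
  have _ : LocallyConvexSpace ℝ E :=
    (PolynormableSpace.withSeminorms 𝕜 E).toLocallyConvexSpace
  by_contra hdense
  obtain ⟨x, hx⟩ : ∃ x, x ∉ closure (D : Set E) := by
    simpa [Dense] using hdense
  have hconv : Convex ℝ (D.topologicalClosure : Set E) :=
    (D.topologicalClosure.restrictScalars ℝ).convex
  obtain ⟨f, u, hfx, hfD⟩ := RCLike.geometric_hahn_banach_point_closed (𝕜 := 𝕜) hconv
    D.isClosed_topologicalClosure hx
  have hu : u < 0 := by simpa using hfD 0 (zero_mem _)
  have hf : f = 0 := by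
    refine hD f fun y hy => ?_
    by_contra hne
    -- This multiple of `y` lies in `D` and `f` takes the value `u` there, against the strict bound
    -- on `D`.
    have h := hfD (((u : 𝕜) * (f y)⁻¹) • y)
      (D.le_topologicalClosure (D.smul_mem _ hy))
    rw [map_smul, smul_eq_mul, mul_assoc, inv_mul_cancel₀ hne] at h
    simp at h
  simp only [hf, zero_apply, map_zero] at hfx
  linarith

/-- A subspace of the weak dual is weak-* dense if it separates points. -/
theorem WeakDual.dense_of_forall_eq_zero {E : Type*} [AddCommGroup E] [Module 𝕜 E]
    [TopologicalSpace E] (M : Submodule 𝕜 (WeakDual 𝕜 E))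
    (hM : ∀ x : E, (∀ f ∈ M, f x = 0) → x = 0) : Dense (M : Set (WeakDual 𝕜 E)) := by
  have hp : PolynormableSpace 𝕜 (WeakDual 𝕜 E) :=
    ((topDualPairing 𝕜 E).weakBilin_withSeminorms).toPolynormableSpace
  refine M.dense_of_forall_strongDual_eq_zero fun φ hφ => ?_
  -- Weak-* continuous functionals are evaluations at points.
  obtain ⟨x, hx⟩ := LinearMap.dualEmbedding_surjective (B := topDualPairing 𝕜 E) φ
  have hφx : ∀ f : WeakDual 𝕜 E, φ f = f x := fun f => (DFunLike.congr_fun hx f).symm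
  have h0 : x = 0 := hM x fun f hf => (hφx f).symm.trans (hφ f hf)
  ext f
  rw [hφx f, h0]
  exact map_zero _

/-- Hahn-Banach extension of `c • x ↦ c * p x` from the line through `x`. -/
theorem Seminorm.exists_strongDual_apply_eq {E : Type*} [AddCommGroup E] [Module 𝕜 E]
    [TopologicalSpace E] [PolynormableSpace 𝕜 E]
    {p : Seminorm 𝕜 E} (hp : Continuous p) (x : E) :
    ∃ f : StrongDual 𝕜 E, (∀ y, ‖f y‖ ≤ p y) ∧ f x = (p x : 𝕜) := by
  by_cases hx : x = 0
  · exact ⟨0, by simp, by simp [hx]⟩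
  let e := LinearEquiv.toSpanNonzeroSingleton 𝕜 E x hx
  let g : Module.Dual 𝕜 (Submodule.span 𝕜 {x}) :=
    (p x : 𝕜) • (e.symm : Submodule.span 𝕜 {x} →ₗ[𝕜] 𝕜)
  have hg : ∀ c : 𝕜, g (e c) = p x * c := by simp [g, RCLike.real_smul_eq_coe_mul]
  obtain ⟨f, hfg, hfp⟩ := Module.Dual.exists_continuous_extension_of_le_seminorm _ g hp (by
    intro y
    obtain ⟨c, rfl⟩ := e.surjective y
    rw [hg]
    simp [e, LinearEquiv.toSpanNonzeroSingleton_apply, map_smul_eq_mul, mul_comm, abs_of_nonneg (apply_nonneg p x)])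
  refine ⟨f, hfp, ?_⟩
  have h := hfg (e 1)
  rw [hg] at h
  simpa [e, LinearEquiv.toSpanNonzeroSingleton_apply] using h

theorem Seminorm.le_of_forall_strongDual {E : Type*} [AddCommGroup E] [Module 𝕜 E]
    [TopologicalSpace E] [PolynormableSpace 𝕜 E]
    {p : Seminorm 𝕜 E} (hp : Continuous p) {x : E} {c : ℝ}
    (h : ∀ f : StrongDual 𝕜 E, (∀ y, ‖f y‖ ≤ p y) → ‖f x‖ ≤ c) : p x ≤ c := by
  obtain ⟨f, hf, hfx⟩ := p.exists_strongDual_apply_eq hp x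
  simpa [hfx, abs_of_nonneg (apply_nonneg p x)] using h f hf

theorem PolynormableSpace.eq_of_forall_strongDual_eq {E : Type*} [AddCommGroup E] [Module 𝕜 E]
    [TopologicalSpace E] [PolynormableSpace 𝕜 E] [T2Space E] {x y : E}
    (h : ∀ f : StrongDual 𝕜 E, f x = f y) : x = y := by
  by_contra hne
  obtain ⟨p, hp⟩ :=
    (PolynormableSpace.withSeminorms 𝕜 E).separating_of_T1 (x - y) (sub_ne_zero.2 hne)
  obtain ⟨f, -, hf⟩ := p.1.exists_strongDual_apply_eq p.2 (x - y)
  rw [map_sub, h f, sub_self] at hf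
  exact hp (by exact_mod_cast hf.symm)

/-- A continuous seminorm is bounded on bounded sets. -/
theorem Seminorm.bddAbove_image_of_isVonNBounded {E : Type*} [AddCommGroup E] [Module 𝕜 E]
    [TopologicalSpace E] {p : Seminorm 𝕜 E} (hp : Continuous p) {s : Set E}
    (hs : Bornology.IsVonNBounded 𝕜 s) : BddAbove (p '' s) := by
  obtain ⟨r, hr, h⟩ := (hs (p.ball_mem_nhds hp one_pos)).exists_pos
  refine ⟨r, ?_⟩
  rintro _ ⟨x, hx, rfl⟩
  obtain ⟨y, hy, rfl⟩ := h (r : 𝕜) (by simp [abs_of_pos hr]) hx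
  rw [p.mem_ball_zero] at hy
  simp only [map_smul_eq_mul, RCLike.norm_ofReal, abs_of_pos hr]
  nlinarith

/-- A functional bounded by `1` on the open unit ball of a seminorm is dominated by it. -/
theorem Seminorm.norm_le_of_forall_lt_one {E : Type*} [AddCommGroup E] [Module 𝕜 E]
    {p : Seminorm 𝕜 E} {f : E →ₗ[𝕜] 𝕜} (h : ∀ x, p x < 1 → ‖f x‖ ≤ 1) (x : E) : ‖f x‖ ≤ p x := by
  refine le_of_forall_gt_imp_ge_of_dense fun c hc => ?_
  have hc0 : 0 < c := (apply_nonneg p x).trans_lt hc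
  have hx := h ((c : 𝕜)⁻¹ • x) (by
    rw [map_smul_eq_mul, norm_inv, RCLike.norm_ofReal, abs_of_pos hc0]
    exact (inv_mul_lt_one₀ hc0).2 hc)
  rw [map_smul, norm_smul, norm_inv, RCLike.norm_ofReal, abs_of_pos hc0] at hx
  exact (inv_mul_le_one₀ hc0).1 hx

theorem PolynormableSpace.exists_ball_subset {E : Type*} [AddCommGroup E] [Module 𝕜 E]
    [TopologicalSpace E] [IsTopologicalAddGroup E] [ContinuousSMul 𝕜 E] [PolynormableSpace 𝕜 E]
    {U : Set E} (hU : U ∈ 𝓝 0) :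
    ∃ p : Seminorm 𝕜 E, Continuous p ∧ p.ball 0 1 ⊆ U := by
  have hE := PolynormableSpace.withSeminorms 𝕜 E
  obtain ⟨s, r, hr, hs⟩ := (hE.mem_nhds_iff 0 U).1 hU
  -- Dividing the seminorm by `r` normalises the radius to `1`.
  have hball : (r.toNNReal⁻¹ • s.sup fun p : {p : Seminorm 𝕜 E // Continuous p} => p.1).ball 0 1 =
      (s.sup fun p : {p : Seminorm 𝕜 E // Continuous p} => p.1).ball 0 r := by
    ext x
    simp only [Seminorm.mem_ball_zero, smul_apply, NNReal.smul_def, NNReal.coe_inv,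
      Real.coe_toNNReal r hr.le, smul_eq_mul, inv_mul_lt_one₀ hr]
  refine ⟨_, Seminorm.continuous (r := 1) ?_, hball ▸ hs⟩
  rw [hball]
  exact (hE.mem_nhds_iff 0 _).2 ⟨s, r, hr, subset_rfl⟩

/-- A set of functionals dominated by a continuous seminorm is bounded in the strong dual. -/
theorem StrongDual.isVonNBounded_of_le_seminorm {E : Type*} [AddCommGroup E] [Module 𝕜 E]
    [TopologicalSpace E] [IsTopologicalAddGroup E] [ContinuousSMul 𝕜 E]
    {p : Seminorm 𝕜 E} (hp : Continuous p) :
    Bornology.IsVonNBounded 𝕜 {f : StrongDual 𝕜 E | ∀ x, ‖f x‖ ≤ p x} := by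
  rw [ContinuousLinearMap.isVonNBounded_iff]
  intro s hs
  obtain ⟨C, hC⟩ := p.bddAbove_image_of_isVonNBounded hp hs
  rw [NormedSpace.isVonNBounded_iff, isBounded_iff_forall_norm_le]
  refine ⟨C, ?_⟩
  rintro _ ⟨f, hf, x, hx, rfl⟩
  exact (hf x).trans (hC ⟨x, hx, rfl⟩)

end PolynormableSpaces

/-! ### Barrelledness and equicontinuity -/

section Barrelled

universe u

variable {𝕜 : Type*} [RCLike 𝕜]

/-- A lower semicontinuous seminorm pulls back to one on each Banach space, where it is continuous
since Banach spaces are barrelled; so its closed unit ball passes the ultrabornological test. -/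
theorem IsUltrabornological.barrelledSpace {E : Type u} [AddCommGroup E] [Module 𝕜 E]
    [TopologicalSpace E] [IsTopologicalAddGroup E] [ContinuousSMul 𝕜 E]
    (hE : IsUltrabornological 𝕜 E) : BarrelledSpace 𝕜 E where
  continuous_of_lowerSemicontinuous p hp := by
    refine Seminorm.continuous' (r := 1) (hE _ ⟨p.balanced_closedBall_zero 1, ?_⟩ ?_)
    · intro x hx y hy a b ha hb hab
      rw [p.mem_closedBall_zero] at hx hy ⊢
      have hnorm : ‖a‖ + ‖b‖ = 1 := by
        have h : ((‖a‖ + ‖b‖ : ℝ) : 𝕜) = 1 := by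
          rw [RCLike.ofReal_add, RCLike.norm_of_nonneg' ha, RCLike.norm_of_nonneg' hb, hab]
        exact_mod_cast h
      calc p (a • x + b • y) ≤ p (a • x) + p (b • y) := map_add_le_add p _ _
        _ = ‖a‖ * p x + ‖b‖ * p y := by rw [map_smul_eq_mul, map_smul_eq_mul]
        _ ≤ ‖a‖ * 1 + ‖b‖ * 1 := by gcongr
        _ = 1 := by rw [mul_one, mul_one, hnorm]
    · intro X _ _ _ i
      have hc : Continuous (p.comp (i : X →ₗ[𝕜] E)) :=
        Seminorm.continuous_of_lowerSemicontinuous _ (fun x c hc =>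
          i.continuous.continuousAt.eventually (hp (i x) c hc))
      refine Filter.mem_of_superset (Seminorm.ball_mem_nhds hc one_pos) fun x hx => ?_
      rw [Seminorm.mem_ball_zero] at hx
      simpa [Seminorm.mem_closedBall_zero] using hx.le

variable {Y Z : Type*} [AddCommGroup Y] [Module 𝕜 Y] [TopologicalSpace Y]
  [ContinuousSMul 𝕜 Y] [BarrelledSpace 𝕜 Y]
  [AddCommGroup Z] [Module 𝕜 Z] [TopologicalSpace Z] [IsTopologicalAddGroup Z]
  [ContinuousSMul 𝕜 Z]

/-- A continuous linear map into the strong dual of a barrelled space maps equicontinuous sets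
to equicontinuous sets. -/
theorem BarrelledSpace.exists_seminorm_of_strongDual_map (S : StrongDual 𝕜 Z →L[𝕜] StrongDual 𝕜 Y)
    {q : Seminorm 𝕜 Z} (hq : Continuous q) :
    ∃ p : Seminorm 𝕜 Y, Continuous p ∧
      ∀ f : StrongDual 𝕜 Z, (∀ z, ‖f z‖ ≤ q z) → ∀ y, ‖S f y‖ ≤ p y := by
  let P : {f : StrongDual 𝕜 Z // ∀ z, ‖f z‖ ≤ q z} → Seminorm 𝕜 Y :=
    fun f => (S f.1).toLinearMap.toSeminorm
  -- The dominated functionals are strongly bounded, so their images under `S` are pointwise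
  -- bounded; barrelledness then makes the supremum continuous.
  have hP : BddAbove (Set.range P) := by
    rw [Seminorm.bddAbove_range_iff]
    intro y
    have hb := ContinuousLinearMap.isVonNBounded_image2_apply
      ((StrongDual.isVonNBounded_of_le_seminorm hq).image S)
      (Bornology.isVonNBounded_singleton (𝕜 := 𝕜) y)
    rw [NormedSpace.isVonNBounded_iff, isBounded_iff_forall_norm_le] at hb
    obtain ⟨C, hC⟩ := hb
    refine ⟨C, ?_⟩
    rintro _ ⟨f, rfl⟩
    exact hC _ ⟨_, ⟨f.1, f.2, rfl⟩, y, rfl, rfl⟩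
  refine ⟨⨆ f, P f, ?_, fun f hf y => le_ciSup hP ⟨f, hf⟩ y⟩
  rw [Seminorm.coe_iSup_eq hP]
  exact Seminorm.continuous_iSup P (fun f => (S f.1).continuous.norm) hP

end Barrelled


/-! ### Realising an isomorphism of strong duals as a transpose -/

section Transpose

variable {𝕜 : Type*} [RCLike 𝕜]
  {Y : Type*} [AddCommGroup Y] [Module 𝕜 Y] [UniformSpace Y] [IsUniformAddGroup Y]
  [ContinuousSMul 𝕜 Y]
  {Z : Type*} [AddCommGroup Z] [Module 𝕜 Z] [UniformSpace Z] [IsUniformAddGroup Z]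
  [ContinuousSMul 𝕜 Z]

/-- A continuous linear map between strong duals that is a transpose on a dense subspace is the
transpose of a continuous linear map. -/
theorem exists_transpose_eq_of_dense [BarrelledSpace 𝕜 Y] [PolynormableSpace 𝕜 Z] [T2Space Z]
    [CompleteSpace Z]
    (S : StrongDual 𝕜 Z →L[𝕜] StrongDual 𝕜 Y) (D : Submodule 𝕜 Y) (hD : Dense (D : Set Y))
    (hS : ∀ y ∈ D, ∃ z : Z, ∀ f, S f y = f z) :
    ∃ lam : Y →L[𝕜] Z, ∀ f y, S f y = f (lam y) := by
  choose g hg using fun y : D => hS y y.2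
  let G : D →ₗ[𝕜] Z :=
    { toFun := g
      map_add' := fun x y => PolynormableSpace.eq_of_forall_strongDual_eq (𝕜 := 𝕜) fun f => by
        rw [← hg, map_add, ← hg, ← hg, Submodule.coe_add, map_add]
      map_smul' := fun c x => PolynormableSpace.eq_of_forall_strongDual_eq (𝕜 := 𝕜) fun f => by
        rw [← hg, RingHom.id_apply, map_smul, ← hg, Submodule.coe_smul, map_smul] }
  have hG : Continuous G := by
    refine WithSeminorms.continuous_of_continuous_comp (PolynormableSpace.withSeminorms 𝕜 Z) G
      fun q => ?_
    obtain ⟨p, hp, hpS⟩ := BarrelledSpace.exists_seminorm_of_strongDual_map S q.2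
    refine Seminorm.continuous_of_le (q := p.comp D.subtype)
      (hp.comp continuous_subtype_val) fun x => ?_
    -- `q (G x)` is controlled by the values `f (G x) = S f x` with `f` dominated by `q`, all of
    -- norm at most `p x`.
    refine Seminorm.le_of_forall_strongDual q.2 fun f hf => ?_
    rw [show G x = g x from rfl, ← hg]
    exact hpS f hf x
  have _ : IsUniformAddGroup D := D.toAddSubgroup.isUniformAddGroup
  have hdense : DenseRange D.subtypeL := by simpa [DenseRange] using hD
  have hind : IsUniformInducing D.subtypeL := ⟨rfl⟩
  refine ⟨ContinuousLinearMap.extend ⟨G, hG⟩ D.subtypeL, fun f y => ?_⟩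
  refine congrFun (hdense.equalizer (S f).continuous
    (f.continuous.comp (ContinuousLinearMap.continuous _)) (funext fun x => ?_)) y
  simp only [Function.comp_apply]
  rw [ContinuousLinearMap.extend_eq _ hdense hind]
  exact hg x f

/-- A continuous linear map into a barrelled space is inducing if its transpose has a continuous
inverse. -/
theorem isInducing_of_transpose_eq [PolynormableSpace 𝕜 Y] [BarrelledSpace 𝕜 Z]
    (S : StrongDual 𝕜 Z ≃L[𝕜] StrongDual 𝕜 Y) (lam : Y →L[𝕜] Z)
    (hlam : ∀ f y, S f y = f (lam y)) : IsInducing lam := by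
  rw [IsTopologicalAddGroup.isInducing_iff_nhds_zero]
  refine le_antisymm ((map_zero lam ▸ lam.continuous.tendsto 0).le_comap) ?_
  rw [(SeminormFamily.withSeminorms_iff_nhds_eq_iInf _).1 (PolynormableSpace.withSeminorms 𝕜 Y)]
  refine le_iInf fun p => tendsto_iff_comap.1 ?_
  obtain ⟨q, hq, hpq⟩ := BarrelledSpace.exists_seminorm_of_strongDual_map
    (S.symm : StrongDual 𝕜 Y →L[𝕜] StrongDual 𝕜 Z) p.2
  have hle : ∀ y, p.1 y ≤ q (lam y) := fun y =>
    Seminorm.le_of_forall_strongDual p.2 fun f hf => by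
      have h := hpq f hf (lam y)
      rwa [← hlam, ContinuousLinearEquiv.coe_coe, S.apply_symm_apply] at h
  exact squeeze_zero (fun y => apply_nonneg p.1 y) hle
    ((map_zero q ▸ hq.tendsto 0).comp tendsto_comap)

/-- A continuous linear map with injective transpose has dense range. -/
theorem denseRange_of_transpose_injective {𝕜 Y Z : Type*} [RCLike 𝕜]
    [AddCommGroup Y] [Module 𝕜 Y] [TopologicalSpace Y]
    [AddCommGroup Z] [Module 𝕜 Z] [TopologicalSpace Z] [IsTopologicalAddGroup Z]
    [ContinuousSMul 𝕜 Z] [PolynormableSpace 𝕜 Z]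
    (S : StrongDual 𝕜 Z →ₗ[𝕜] StrongDual 𝕜 Y) (hS : Function.Injective S) (lam : Y →L[𝕜] Z)
    (hlam : ∀ f y, S f y = f (lam y)) : DenseRange lam := by
  refine (LinearMap.range (lam : Y →ₗ[𝕜] Z)).dense_of_forall_strongDual_eq_zero fun f hf => ?_
  refine hS ?_
  ext y
  rw [hlam, map_zero]
  exact hf _ ⟨y, rfl⟩

/-- If a continuous linear map on a `B_r`-complete space has a topological isomorphism as its
transpose, and its codomain is barrelled, then it is surjective. -/
theorem IsBrComplete.surjective_of_transpose_eq [PolynormableSpace 𝕜 Y] [T2Space Y]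
    [PolynormableSpace 𝕜 Z] [T2Space Z] [BarrelledSpace 𝕜 Z]
    (hY : IsBrComplete 𝕜 Y) (S : StrongDual 𝕜 Z ≃L[𝕜] StrongDual 𝕜 Y) (lam : Y →L[𝕜] Z)
    (hlam : ∀ f y, S f y = f (lam y)) : Function.Surjective lam := by
  intro z₀
  by_contra! hz₀
  have hdense := denseRange_of_transpose_injective (S : StrongDual 𝕜 Z →ₗ[𝕜] StrongDual 𝕜 Y)
    S.injective lam hlam
  -- `M` is the image under `S` of the annihilator of `z₀`: a proper subspace that will violate
  -- `B_r`-completeness.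
  let M : Submodule 𝕜 (WeakDual 𝕜 Y) :=
    { carrier := {f | S.symm (WeakDual.toStrongDual f) z₀ = 0}
      add_mem' := fun {f g} hf hg => by
        simp only [Set.mem_ofPred_eq, map_add, add_apply] at *
        rw [hf, hg, add_zero]
      zero_mem' := by simp
      smul_mem' := fun c f hf => by
        simp only [Set.mem_ofPred_eq, map_smul, smul_apply] at *
        rw [hf, smul_zero] }
  have hMmem : ∀ f : WeakDual 𝕜 Y, f ∈ M ↔ S.symm (WeakDual.toStrongDual f) z₀ = 0 :=
    fun f => Iff.rfl
  have hMS : ∀ f : StrongDual 𝕜 Z, f z₀ = 0 → StrongDual.toWeakDual (S f) ∈ M := fun f hf => by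
    rw [hMmem]; simpa using hf
  have hsymm : ∀ (f : WeakDual 𝕜 Y) y, S.symm (WeakDual.toStrongDual f) (lam y) = f y := by
    intro f y
    rw [← hlam, ContinuousLinearEquiv.apply_symm_apply]
    rfl
  have hne : z₀ ≠ 0 := fun h => hz₀ 0 (by rw [map_zero, h])
  obtain ⟨f₀, hf₀⟩ : ∃ f : StrongDual 𝕜 Z, f z₀ ≠ 0 := by
    by_contra! h
    exact hne (PolynormableSpace.eq_of_forall_strongDual_eq (𝕜 := 𝕜) fun f => by
      rw [h f, map_zero])
  have hM : Dense (M : Set (WeakDual 𝕜 Y)) := by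
    refine WeakDual.dense_of_forall_eq_zero M fun y hy => ?_
    -- If `M` annihilates `y`, then `lam y` is a multiple of `z₀`. As `z₀` is not in the range, the
    -- factor is zero, and `y = 0` because `S` is onto.
    have hker : ∀ f : StrongDual 𝕜 Z, f z₀ = 0 → f (lam y) = 0 := fun f hf => by
      rw [← hlam]; exact hy _ (hMS f hf)
    have hmul : lam y = (f₀ (lam y) / f₀ z₀) • z₀ := by
      refine PolynormableSpace.eq_of_forall_strongDual_eq (𝕜 := 𝕜) fun f => ?_
      have h := hker (f - (f z₀ / f₀ z₀) • f₀) (by simp [hf₀])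
      simp only [sub_apply, smul_apply, smul_eq_mul, sub_eq_zero] at h
      rw [h, map_smul, smul_eq_mul]
      ring
    have hc : f₀ (lam y) / f₀ z₀ = 0 := by
      by_contra hc
      refine hz₀ ((f₀ (lam y) / f₀ z₀)⁻¹ • y) ?_
      rw [map_smul]
      nth_rewrite 2 [hmul]
      rw [smul_smul, inv_mul_cancel₀ hc, one_smul]
    rw [hc, zero_smul] at hmul
    refine PolynormableSpace.eq_of_forall_strongDual_eq (𝕜 := 𝕜) fun g => ?_
    rw [← S.apply_symm_apply g, hlam, hlam, hmul, map_zero lam]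
  have htop := hY M hM fun U hU => by
    obtain ⟨p, hp, hpU⟩ := PolynormableSpace.exists_ball_subset (𝕜 := 𝕜) hU
    have hpolar : ∀ f ∈ WeakDual.polar 𝕜 U, ∀ y, ‖f y‖ ≤ p y := fun f hf =>
      Seminorm.norm_le_of_forall_lt_one (f := (WeakDual.toStrongDual f).toLinearMap)
        fun y hy => hf y (hpU (p.mem_ball_zero.2 hy))
    obtain ⟨q, hq, hpq⟩ := BarrelledSpace.exists_seminorm_of_strongDual_map
      (S.symm : StrongDual 𝕜 Y →L[𝕜] StrongDual 𝕜 Z) hp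
    refine isClosed_of_closure_subset fun f hf => ?_
    have hfU : f ∈ WeakDual.polar 𝕜 U :=
      closure_minimal Set.inter_subset_right (WeakDual.isClosed_polar 𝕜 U) hf
    refine ⟨?_, hfU⟩
    rw [SetLike.mem_coe, hMmem]
    refine norm_le_zero_iff.1 (le_of_forall_pos_le_add fun ε hε => ?_)
    -- On `U°` all `S⁻¹ f` are dominated by the same `q`, so evaluation at `z₀` is uniformly close
    -- to evaluation at `lam y`, which is the weak-* continuous map `f ↦ f y`.
    obtain ⟨y, hy⟩ : ∃ y, q (z₀ - lam y) < ε / 3 :=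
      hdense.exists_mem_open (isOpen_lt (hq.comp (continuous_const.sub continuous_id))
        continuous_const) ⟨z₀, by simpa using hε⟩
    obtain ⟨g, hg, hgM, hgU⟩ := mem_closure_iff.1 hf {g | ‖f y - g y‖ < ε / 3} (by
      refine isOpen_lt ?_ continuous_const
      exact (continuous_const.sub (WeakDual.eval_continuous y)).norm) (by simpa using hε)
    rw [SetLike.mem_coe, hMmem] at hgM
    have h1 := hpq f (hpolar f hfU) (z₀ - lam y)
    have h2 := hpq g (hpolar g hgU) (z₀ - lam y)
    have hg' : ‖f y - g y‖ < ε / 3 := hg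
    have hgz : S.symm (WeakDual.toStrongDual g) z₀ = 0 := hgM
    have hsplit : S.symm (WeakDual.toStrongDual f) z₀ =
        S.symm (WeakDual.toStrongDual f) (z₀ - lam y) -
          S.symm (WeakDual.toStrongDual g) (z₀ - lam y) + (f y - g y) := by
      rw [map_sub, map_sub, hsymm, hsymm, hgz]
      ring
    rw [zero_add, hsplit]
    refine (norm_add_le _ _).trans ?_
    have h3 := norm_sub_le (S.symm (WeakDual.toStrongDual f) (z₀ - lam y))
      (S.symm (WeakDual.toStrongDual g) (z₀ - lam y))
    have h1' : ‖S.symm (WeakDual.toStrongDual f) (z₀ - lam y)‖ ≤ q (z₀ - lam y) := h1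
    have h2' : ‖S.symm (WeakDual.toStrongDual g) (z₀ - lam y)‖ ≤ q (z₀ - lam y) := h2
    linarith
  refine hf₀ ?_
  have h : StrongDual.toWeakDual (S f₀) ∈ M := htop ▸ Submodule.mem_top
  rw [hMmem] at h
  simpa using h

/-- If a continuous linear map on a complete space has a topological isomorphism as its transpose,
and its codomain is barrelled, then it is surjective. -/
theorem surjective_of_transpose_eq [PolynormableSpace 𝕜 Y] [CompleteSpace Y]
    [PolynormableSpace 𝕜 Z] [T2Space Z] [BarrelledSpace 𝕜 Z]
    (S : StrongDual 𝕜 Z ≃L[𝕜] StrongDual 𝕜 Y) (lam : Y →L[𝕜] Z)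
    (hlam : ∀ f y, S f y = f (lam y)) : Function.Surjective lam := by
  have hcl : IsClosed (Set.range lam) :=
    (AddMonoidHom.isUniformInducing_of_isInducing
      (isInducing_of_transpose_eq S lam hlam)).isComplete_range.isClosed
  have hdense := denseRange_of_transpose_injective (S : StrongDual 𝕜 Z →ₗ[𝕜] StrongDual 𝕜 Y)
    S.injective lam hlam
  rw [← Set.range_eq_univ, ← hcl.closure_eq, hdense.closure_range]

/-- A surjective continuous linear map into a barrelled space whose transpose is a topological
isomorphism is itself one. -/
theorem exists_continuousLinearEquiv_of_transpose_eq [PolynormableSpace 𝕜 Y] [T2Space Y]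
    [BarrelledSpace 𝕜 Z] (S : StrongDual 𝕜 Z ≃L[𝕜] StrongDual 𝕜 Y) (lam : Y →L[𝕜] Z)
    (hlam : ∀ f y, S f y = f (lam y)) (hsurj : Function.Surjective lam) :
    ∃ e : Y ≃L[𝕜] Z, (e : Y →L[𝕜] Z) = lam := by
  have hind := isInducing_of_transpose_eq S lam hlam
  let e := LinearEquiv.ofBijective (lam : Y →ₗ[𝕜] Z) ⟨hind.injective, hsurj⟩
  have he : ∀ z, lam (e.symm z) = z := e.apply_symm_apply
  refine ⟨⟨e, lam.continuous, hind.continuous_iff.2 ?_⟩, rfl⟩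
  exact continuous_id.congr fun z => (he z).symm

end Transpose

/-! ### Strong linearisations -/

section Linearisation

variable {𝕜 : Type*} [RCLike 𝕜] {Ω : Type*} {F : Submodule 𝕜 (Ω → 𝕜)}
  [TopologicalSpace (FunctionSpace F)] {Y : Type*} [AddCommGroup Y] [Module 𝕜 Y]
  [TopologicalSpace Y]

theorem IsStrongLinearisation.apply {δ : Ω → Y} {T : FunctionSpace F ≃L[𝕜] StrongDual 𝕜 Y}
    (h : IsStrongLinearisation δ T) (f : FunctionSpace F) (x : Ω) : T f (δ x) = f x :=
  congrFun (h f) x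

theorem IsStrongLinearisation.dense_span [IsTopologicalAddGroup Y] [ContinuousSMul 𝕜 Y]
    [PolynormableSpace 𝕜 Y] {δ : Ω → Y} {T : FunctionSpace F ≃L[𝕜] StrongDual 𝕜 Y}
    (h : IsStrongLinearisation δ T) : Dense (Submodule.span 𝕜 (Set.range δ) : Set Y) := by
  refine Submodule.dense_of_forall_strongDual_eq_zero _ fun f hf => ?_
  have h0 : T.symm f = 0 := by
    refine Subtype.ext (funext fun x => ?_)
    rw [← h.apply, T.apply_symm_apply]
    exact hf _ (Submodule.subset_span ⟨x, rfl⟩)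
  simpa using h0

theorem IsStrongLinearisation.mem_weakBoundedFunctions [IsTopologicalAddGroup Y]
    [ContinuousSMul 𝕜 Y] {δ : Ω → Y} {T : FunctionSpace F ≃L[𝕜] StrongDual 𝕜 Y}
    (h : IsStrongLinearisation δ T) : δ ∈ weakBoundedFunctions F Y := by
  have hδ : ∀ e : StrongDual 𝕜 Y, (fun x => e (δ x)) = (T.symm e).1 := fun e => by
    funext x
    rw [← h.apply, T.apply_symm_apply]
  refine ⟨fun e => hδ e ▸ (T.symm e).2, fun q p hq hp => ?_⟩
  -- The polar is strongly bounded, and `T⁻¹` carries it to a bounded subset of the function space.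
  have hb := (StrongDual.isVonNBounded_of_le_seminorm hp).image
    (T.symm : StrongDual 𝕜 Y →L[𝕜] FunctionSpace F)
  refine (q.bddAbove_image_of_isVonNBounded hq hb).mono ?_
  rintro _ ⟨e, he, rfl⟩
  refine ⟨T.symm e, ⟨e, fun x => ?_, rfl⟩, congrArg q (Subtype.ext (hδ e).symm)⟩
  exact Seminorm.norm_le_of_forall_lt_one (f := e.toLinearMap) he x

end Linearisation

theorem mainTheorem7 {𝕜 : Type*} [RCLike 𝕜] {Ω : Type*} [Nonempty Ω]
    (F : Submodule 𝕜 (Ω → 𝕜))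
    [TopologicalSpace (FunctionSpace F)] [IsTopologicalAddGroup (FunctionSpace F)]
    [ContinuousSMul 𝕜 (FunctionSpace F)] [PolynormableSpace 𝕜 (FunctionSpace F)]
    [T2Space (FunctionSpace F)]
    {Y : Type*} [AddCommGroup Y] [Module 𝕜 Y] [UniformSpace Y] [IsUniformAddGroup Y]
    [ContinuousSMul 𝕜 Y] [PolynormableSpace 𝕜 Y] [T2Space Y]
    {Z : Type*} [AddCommGroup Z] [Module 𝕜 Z] [UniformSpace Z] [IsUniformAddGroup Z]
    [ContinuousSMul 𝕜 Z] [PolynormableSpace 𝕜 Z] [T2Space Z] [CompleteSpace Z]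
    (δ : Ω → Y) (T : FunctionSpace F ≃L[𝕜] StrongDual 𝕜 Y) (hδ : IsStrongLinearisation δ T)
    (T' : FunctionSpace F ≃L[𝕜] StrongDual 𝕜 Z)
    (h : (CompleteSpace Y ∧ BarrelledSpace 𝕜 Y ∧ IsWebbed 𝕜 Y ∧ IsUltrabornological 𝕜 Z) ∨
      (IsBrComplete 𝕜 Y ∧ BarrelledSpace 𝕜 Y ∧ BarrelledSpace 𝕜 Z)) :
    ((∃ δ' ∈ weakBoundedFunctions F Z, IsStrongLinearisation δ' T') → PredualEquiv T' T) ∧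
    (IsBCSpace 𝕜 (FunctionSpace F) →
      (∀ x : Ω, Continuous (fun f : FunctionSpace F => f x)) →
      PredualEquiv T' T → ∃ δ' ∈ weakBoundedFunctions F Z, IsStrongLinearisation δ' T') := by
  have hY : BarrelledSpace 𝕜 Y := h.elim (fun h => h.2.1) fun h => h.2.1
  have hZ : BarrelledSpace 𝕜 Z := h.elim (fun h => h.2.2.2.barrelledSpace) fun h => h.2.2
  constructor
  · rintro ⟨δ', -, hδ'⟩
    let S : StrongDual 𝕜 Z ≃L[𝕜] StrongDual 𝕜 Y := T'.symm.trans T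
    have hS : ∀ f, S f = T (T'.symm f) := fun _ => rfl
    obtain ⟨lam, hlam⟩ := exists_transpose_eq_of_dense
      (S : StrongDual 𝕜 Z →L[𝕜] StrongDual 𝕜 Y) _ hδ.dense_span (by
        intro y hy
        induction hy using Submodule.span_induction with
        | mem y hy =>
          obtain ⟨x, rfl⟩ := hy
          refine ⟨δ' x, fun f => ?_⟩
          -- Both sides are the value at `x` of the function `T'⁻¹ f`.
          rw [ContinuousLinearEquiv.coe_coe, hS, hδ.apply, ← hδ'.apply, T'.apply_symm_apply]
        | zero => exact ⟨0, by simp⟩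
        | add y₁ y₂ _ _ h₁ h₂ =>
          obtain ⟨z₁, hz₁⟩ := h₁
          obtain ⟨z₂, hz₂⟩ := h₂
          exact ⟨z₁ + z₂, fun f => by rw [map_add, map_add, hz₁, hz₂]⟩
        | smul c y _ hy =>
          obtain ⟨z, hz⟩ := hy
          exact ⟨c • z, fun f => by rw [map_smul, map_smul, hz]⟩)
    have hlam' : ∀ f y, S f y = f (lam y) := hlam
    have hsurj : Function.Surjective lam := by
      rcases h with ⟨_, -⟩ | ⟨hBr, -⟩
      · exact surjective_of_transpose_eq S lam hlam'
      · exact hBr.surjective_of_transpose_eq S lam hlam'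
    obtain ⟨e, he⟩ := exists_continuousLinearEquiv_of_transpose_eq S lam hlam' hsurj
    refine ⟨e, fun f => ?_⟩
    ext y
    rw [he]
    exact (hlam' f y).symm
  · rintro - - ⟨e, he⟩
    have hδ' : IsStrongLinearisation (fun x => e (δ x)) T' := fun f => funext fun x => by
      have h := DFunLike.congr_fun (he (T' f)) (δ x)
      rw [T'.symm_apply_apply, hδ.apply] at h
      exact h
    exact ⟨_, hδ'.mem_weakBoundedFunctions, hδ'⟩
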